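/- Let $d,h\ge 0$ and $n\ge 1$ be integers, let the state space be $[-1,1]^d$, let $A$ be a measurable space of actions, and let $T:[-1,1]^d\times A\to[-1,1]^d$ be a measurable deterministic one-step transition function. For $\mathbf a_h=\langle a_1,\dots,a_h\rangle\in A^h$ let $T_h(s,\mathbf a_h)$ be the state reached from $s$ by executing $a_1,\dots,a_h$ in order. Let $P$ be any probability distribution of $(s,\mathbf a_h)$ on $[-1,1]^d\times A^h$, and let the dataset $D$ consist of $|D|=n$ independent draws $(s^i,\mathbf a_h^i)\sim P$ together with the labels $T_h(s^i,\mathbf a_h^i)$. Let $\mathcal F$ be a set of measurable functions $f:[-1,1]^d\times A^h\to[-1,1]$ for which suprema over $f\in\mathcal F$ are measurable, in the following sense: for all $m\ge0$, all $c_0,\dots,c_m\in\mathbb R$ and every bounded measurable $\varphi(x,y)$, $x\in[-1,1]^d\times A^h$, $y\in[-1,1]$, that is continuous in $y$, the function $(x_1,\dots,x_m)\mapsto\sup_{f\in\mathcal F}\big(c_0\,\mathbb E_{x\sim P}[\varphi(x,f(x))]+\sum_{j=1}^m c_j\,\varphi(x_j,f(x_j))\big)$ is measurable. Let $$\mathcal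 T_h:=\{\widehat T_h=\langle f_1,\dots,f_d\rangle : f_j\in\mathcal F\ \text{for all } j\},$$ $$\mathrm{Rad}(\mathcal T_h):=\mathbb E_{s^i,\mathbf a_h^i,\sigma_{ij}}\Big[\sup_{\widehat T_h\in\mathcal T_h}\frac1{|D|}\sum_{i=1}^{|D|}\sum_{j=1}^d\sigma_{ij}\,\widehat T_h(s^i,\mathbf a_h^i)_j\Big],$$ where the $\sigma_{ij}$ are independent, uniform on $\{-1,1\}$, and independent of the data. Then for every $\delta\in(0,1)$, with probability at least $1-\delta$ over the draw of $D$, every $\widehat T_h\in\mathcal T_h$ (in particular one that was fitted to $D$) satisfies $$\mathbb E_{(s,\mathbf a_h)\sim P}\big\|T_h(s,\mathbf a_h)-\widehat T_h(s,\mathbf a_h)\big\|_1\ \le\ 2\sqrt2\,\mathrm{Rad}(\mathcal T_h)+d\sqrt{\frac{2\ln(1/\delta)}{|D|}}+\Delta,$$ where $\Delta:=\frac1{|D|}\sum_{i=1}^{|D|}\|T_h(s^i,\mathbf a_h^i)-\widehat T_h(s^i,\mathbf a_h^i)\|_1$ is the training error of $\widehat T_h$. -/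

import Mathlib

open MeasureTheory

noncomputable section

/-- The interval `[-1, 1]`. -/
abbrev UnitBall1 : Type := Set.Icc (-1 : ℝ) 1

/-- The state space `[-1, 1]^d`. -/
abbrev StateSpace (d : ℕ) : Type := Fin d → UnitBall1

/-- Inputs of an `h`-step model: a state `s` and a sequence of actions `a₁, …, a_h`. -/
abbrev ModelInput (A : Type*) (d h : ℕ) : Type _ := StateSpace d × (Fin h → A)

/-- The state reached from `s` by executing `a₁, …, a_h` one after the other, when the one-step
dynamics is `T`. -/
def hStepState {S A : Type*} (T : S → A → S) : (h : ℕ) → S → (Fin h → A) → S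
  | 0, s, _ => s
  | h + 1, s, a => hStepState T h (T s (a 0)) (fun i => a i.succ)

/-- The true `h`-step transition function `(s, a₁, …, a_h) ↦ T_h(s, a₁, …, a_h)`. -/
def hStepTransition {A : Type*} {d : ℕ} (T : StateSpace d → A → StateSpace d) (h : ℕ)
    (x : ModelInput A d h) : StateSpace d :=
  hStepState T h x.1 x.2

/-- The `L¹` distance `‖u - v‖₁` of two states. -/
def l1Dist {d : ℕ} (u v : StateSpace d) : ℝ := ∑ i, |(u i : ℝ) - (v i : ℝ)|

/-- The class of vector-valued functions `⟨f₁, …, f_d⟩` all of whose components lie in `F`. -/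
def vectorClass {X : Type*} (d : ℕ) (F : Set (X → UnitBall1)) : Set (X → StateSpace d) :=
  {g | ∀ i, (fun x => g x i) ∈ F}

/-- Rademacher complexity, for `n` independent samples with law `P`, of a class of functions with
values in `[-1, 1]^d`: the expectation over the sample and over independent uniform signs `σ j i`
of the supremum of `(1 / n) ∑ j, ∑ i, σ j i * g (x j) i`. -/
def rademacherComplexity {X : Type*} [MeasurableSpace X] {d : ℕ} (P : Measure X) (n : ℕ)
    (G : Set (X → StateSpace d)) : ℝ :=
  (Fintype.card (Fin n → Fin d → ℤˣ) : ℝ)⁻¹ * ∑ σ : Fin n → Fin d → ℤˣ,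
    ∫ x : Fin n → X,
      ⨆ g : G, (1 / (n : ℝ)) * ∑ j, ∑ i, ((σ j i : ℤ) : ℝ) * ((g : X → StateSpace d) (x j) i : ℝ)
      ∂(Measure.pi fun _ => P)

/-- Expected `L¹` error of the model `g` with respect to the target `t`, for inputs with law `P`. -/
def generalizationError {X : Type*} [MeasurableSpace X] {d : ℕ} (P : Measure X)
    (t g : X → StateSpace d) : ℝ :=
  ∫ x, l1Dist (t x) (g x) ∂P

/-- Average `L¹` error of the model `g` with respect to the target `t`, on the sample `x`. -/
def trainingError {X : Type*} {d n : ℕ} (t g : X → StateSpace d) (x : Fin n → X) : ℝ :=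
  (1 / (n : ℝ)) * ∑ j, l1Dist (t (x j)) (g (x j))

/-- The measurability that makes expectations and probabilities of suprema over `F` meaningful:
for every bounded `φ (x, y)` that is measurable and continuous in `y`, suprema over `f ∈ F` of
linear combinations of the expectation of `φ (x, f x)` and of its values at sample points are
measurable functions of the sample points. For `F` consisting of measurable functions it
holds for instance if `F` is countable, or if every function in `F` is a pointwise limit of a
sequence from a fixed countable subset of `F`. -/
def HasMeasurableSuprema {X : Type*} [MeasurableSpace X] (P : Measure X)
    (F : Set (X → UnitBall1)) : Prop :=
  ∀ (m : ℕ) (φ : X → UnitBall1 → ℝ), Measurable (Function.uncurry φ) →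
    (∀ x, Continuous (φ x)) → (∃ C : ℝ, ∀ x y, |φ x y| ≤ C) →
    ∀ (c₀ : ℝ) (c : Fin m → ℝ),
      Measurable fun x : Fin m → X =>
        ⨆ f : F, (c₀ * ∫ z, φ z ((f : X → UnitBall1) z) ∂P
          + ∑ j, c j * φ (x j) ((f : X → UnitBall1) (x j)))

end

open MeasureTheory ProbabilityTheory

/-! ### Suprema of bounded families -/

/-! The `L¹` error is a sum over components, and each component of a model ranges over `F`
independently of the others. So the gap between expected and training error is at most the sum over
`i` of the largest gap of the scalar loss `|t_i - f|` over `f ∈ F` (`lossDeviation`). This bound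
depends on the sample only, so it covers models fitted to the sample.

The random variable `lossDeviation` concentrates: changing one of the `n` sample points moves it by
at most `2d/n`, so by McDiarmid's inequality it exceeds its mean by `d √(2 ln(1/δ)/n)` with
probability at most `δ`. Its mean is controlled one component at a time: symmetrization with a ghost
sample gives twice the Rademacher average of the losses, and the contraction principle removes the
loss, since `y ↦ |t_i - y|` is 1-Lipschitz. The resulting `d` scalar complexities add up to the
complexity of the vector class, because its suprema decouple.

Contraction is thus only needed for scalar functions, where its constant is 1. The argument gives
the factor 2; it is enlarged to `2√2` at the end, as the complexity is nonnegative. -/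

theorem bddAbove_range_of_abs_le {ι : Type*} {u : ι → ℝ} {C : ℝ} (hu : ∀ f, |u f| ≤ C) :
    BddAbove (Set.range u) :=
  ⟨C, by rintro _ ⟨f, rfl⟩; exact (abs_le.1 (hu f)).2⟩

theorem abs_ciSup_le {ι : Type*} [Nonempty ι] {u : ι → ℝ} {C : ℝ} (hu : ∀ f, |u f| ≤ C) :
    |⨆ f, u f| ≤ C := by
  have h := le_ciSup (bddAbove_range_of_abs_le hu) (Classical.arbitrary ι)
  exact abs_le.2 ⟨(abs_le.1 (hu _)).1.trans h, ciSup_le fun f => (abs_le.1 (hu f)).2⟩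

theorem abs_ciSup_sub_ciSup_le {ι : Type*} [Nonempty ι] {u v : ι → ℝ} {C D c : ℝ}
    (hu : ∀ f, |u f| ≤ C) (hv : ∀ f, |v f| ≤ D) (h : ∀ f, |u f - v f| ≤ c) :
    |(⨆ f, u f) - ⨆ f, v f| ≤ c := by
  rw [abs_sub_le_iff]
  constructor
  · rw [sub_le_iff_le_add]
    refine ciSup_le fun f => ?_
    have h1 := (abs_le.1 (h f)).2
    have h2 := le_ciSup (bddAbove_range_of_abs_le hv) f
    linarith
  · rw [sub_le_iff_le_add]
    refine ciSup_le fun f => ?_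
    have h1 := (abs_le.1 (h f)).1
    have h2 := le_ciSup (bddAbove_range_of_abs_le hu) f
    linarith

theorem ciSup_add_le_of_abs_le {ι : Type*} [Nonempty ι] {u v : ι → ℝ} {C D : ℝ}
    (hu : ∀ f, |u f| ≤ C) (hv : ∀ f, |v f| ≤ D) :
    ⨆ f, (u f + v f) ≤ (⨆ f, u f) + ⨆ f, v f :=
  ciSup_le fun f => add_le_add (le_ciSup (bddAbove_range_of_abs_le hu) f)
    (le_ciSup (bddAbove_range_of_abs_le hv) f)

/-- The supremum over independent choices of a separable objective is the sum of the suprema. -/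
theorem ciSup_pi_sum {ι κ : Type*} [Fintype κ] [Nonempty ι] {u : κ → ι → ℝ} {C : ℝ}
    (hu : ∀ i f, |u i f| ≤ C) :
    ⨆ g : κ → ι, ∑ i, u i (g i) = ∑ i, ⨆ f, u i f := by
  apply le_antisymm
  · exact ciSup_le fun g => Finset.sum_le_sum fun i _ =>
      le_ciSup (bddAbove_range_of_abs_le (hu i)) (g i)
  · refine le_of_forall_pos_le_add fun ε hε => ?_
    -- Each coordinate may lose an equal share of `ε`; the `+ 1` keeps the share well defined when
    -- `κ` is empty.
    have hc : (0 : ℝ) < Fintype.card κ + 1 := by positivity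
    have h : ∀ i, ∃ f, (⨆ f, u i f) - ε / (Fintype.card κ + 1) < u i f := fun i =>
      exists_lt_of_lt_ciSup (sub_lt_self _ (div_pos hε hc))
    choose g hg using h
    have hb : BddAbove (Set.range fun g : κ → ι => ∑ i, u i (g i)) :=
      ⟨∑ i, ⨆ f, u i f, by
        rintro _ ⟨g, rfl⟩
        exact Finset.sum_le_sum fun i _ => le_ciSup (bddAbove_range_of_abs_le (hu i)) (g i)⟩
    have h1 := le_ciSup hb g
    have h2 : ∑ i, ((⨆ f, u i f) - ε / (Fintype.card κ + 1)) ≤ ∑ i, u i (g i) :=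
      Finset.sum_le_sum fun i _ => (hg i).le
    rw [Finset.sum_sub_distrib, Finset.sum_const, Finset.card_univ, nsmul_eq_mul] at h2
    have h3 : (Fintype.card κ : ℝ) * (ε / (Fintype.card κ + 1)) ≤ ε := by
      rw [mul_div_assoc', div_le_iff₀ hc]
      nlinarith
    linarith

/-! ### Sums over signs -/

theorem abs_units_int (e : ℤˣ) : |((e : ℤ) : ℝ)| = 1 := by
  rcases Int.units_eq_one_or e with rfl | rfl <;> simp

theorem abs_sum_signs_mul_le {n : ℕ} (ε : Fin n → ℤˣ) {v : Fin n → ℝ} {C : ℝ}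
    (hv : ∀ j, |v j| ≤ C) : |∑ j, ((ε j : ℤ) : ℝ) * v j| ≤ n * C := by
  refine (Finset.abs_sum_le_sum_abs _ _).trans ?_
  refine (Finset.sum_le_sum (g := fun _ => C) fun j _ => ?_).trans (by simp)
  rw [abs_mul, abs_units_int, one_mul]
  exact hv j

/-- The case of a single sign in the contraction principle. For competitors `f` and `g` in the two
suprema, `v f - v g ≤ |w f - w g|`. If the absolute value is `w f - w g`, the pair `(f, g)` bounds
the sum on the right; otherwise the exchanged pair `(g, f)` does, because `b` enters both suprema
with the same sign. -/
theorem ciSup_add_ciSup_sub_le {ι : Type*} [Nonempty ι] {b v w : ι → ℝ} {B C : ℝ}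
    (hb : ∀ f, |b f| ≤ B) (hw : ∀ f, |w f| ≤ C)
    (hvw : ∀ f g, |v f - v g| ≤ |w f - w g|) :
    (⨆ f, (b f + v f)) + ⨆ f, (b f - v f) ≤ (⨆ f, (b f + w f)) + ⨆ f, (b f - w f) := by
  have hp : BddAbove (Set.range fun f => b f + w f) :=
    bddAbove_range_of_abs_le fun f => (abs_add_le _ _).trans (add_le_add (hb f) (hw f))
  have hm : BddAbove (Set.range fun f => b f - w f) :=
    bddAbove_range_of_abs_le fun f => (abs_sub _ _).trans (add_le_add (hb f) (hw f))
  rw [← le_sub_iff_add_le]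
  refine ciSup_le fun f => ?_
  rw [le_sub_comm]
  refine ciSup_le fun g => ?_
  have h1 := (le_abs_self _).trans (hvw f g)
  have h2 := le_ciSup hp f
  have h3 := le_ciSup hm g
  have h4 := le_ciSup hp g
  have h5 := le_ciSup hm f
  rcases abs_cases (w f - w g) with ⟨h, _⟩ | ⟨h, _⟩ <;> linarith

theorem sum_signs_succ {n : ℕ} (G : (Fin (n + 1) → ℤˣ) → ℝ) :
    ∑ ε, G ε = ∑ ε : Fin n → ℤˣ, (G (Fin.cons 1 ε) + G (Fin.cons (-1) ε)) := by
  rw [← (Fin.consEquiv fun _ : Fin (n + 1) => ℤˣ).sum_comp, Fintype.sum_prod_type,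
    Finset.sum_add_distrib]
  have : (Finset.univ : Finset ℤˣ) = {1, -1} := by decide
  rw [this, Finset.sum_pair (by decide)]
  rfl

/-- The contraction principle for Rademacher sums (**Ledoux–Talagrand**), one-sided form. -/
theorem sum_signs_ciSup_le_of_contraction {ι : Type*} [Nonempty ι] {C : ℝ} :
    ∀ {n : ℕ} (a : ι → ℝ) (B : ℝ), (∀ f, |a f| ≤ B) → ∀ (v w : Fin n → ι → ℝ),
      (∀ j f, |v j f| ≤ C) → (∀ j f, |w j f| ≤ C) →
      (∀ j f g, |v j f - v j g| ≤ |w j f - w j g|) →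
      ∑ ε : Fin n → ℤˣ, ⨆ f, (a f + ∑ j, ((ε j : ℤ) : ℝ) * v j f) ≤
        ∑ ε : Fin n → ℤˣ, ⨆ f, (a f + ∑ j, ((ε j : ℤ) : ℝ) * w j f) := by
  intro n
  induction n with
  | zero => intro a B _ v w _ _ _; simp
  | succ n ih =>
    intro a B ha v w hv hw hvw
    -- Conditioning on the first sign moves `± u 0` into the offset, which is why the induction runs
    -- over an arbitrary bounded `a`.
    have hs : ∀ u : Fin (n + 1) → ι → ℝ,
        ∑ ε : Fin (n + 1) → ℤˣ, ⨆ f, (a f + ∑ j, ((ε j : ℤ) : ℝ) * u j f) =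
        (∑ ε : Fin n → ℤˣ, ⨆ f, ((a f + u 0 f) + ∑ j, ((ε j : ℤ) : ℝ) * u j.succ f)) +
        ∑ ε : Fin n → ℤˣ, ⨆ f, ((a f - u 0 f) + ∑ j, ((ε j : ℤ) : ℝ) * u j.succ f) := by
      intro u
      rw [sum_signs_succ, ← Finset.sum_add_distrib]
      refine Finset.sum_congr rfl fun ε _ => ?_
      simp [Fin.sum_univ_succ, add_assoc, sub_eq_add_neg]
    rw [hs v, hs w]
    have h1 := ih (fun f => a f + v 0 f) (B + C)
      (fun f => (abs_add_le _ _).trans (add_le_add (ha f) (hv 0 f)))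
      (fun j => v j.succ) (fun j => w j.succ) (fun j => hv j.succ) (fun j => hw j.succ)
      (fun j => hvw j.succ)
    have h2 := ih (fun f => a f - v 0 f) (B + C)
      (fun f => (abs_sub _ _).trans (add_le_add (ha f) (hv 0 f)))
      (fun j => v j.succ) (fun j => w j.succ) (fun j => hv j.succ) (fun j => hw j.succ)
      (fun j => hvw j.succ)
    refine (add_le_add h1 h2).trans ?_
    rw [← Finset.sum_add_distrib, ← Finset.sum_add_distrib]
    refine Finset.sum_le_sum fun ε _ => ?_
    -- The induction hypothesis has replaced all terms but the first; with the other signs fixed,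
    -- their sum joins the offset and the first term is replaced too.
    have h3 := ciSup_add_ciSup_sub_le (v := v 0) (w := w 0)
      (b := fun f => a f + ∑ j, ((ε j : ℤ) : ℝ) * w j.succ f) (B := B + n * C)
      (fun f => (abs_add_le _ _).trans
        (add_le_add (ha f) (abs_sum_signs_mul_le ε fun j => hw j.succ f))) (hw 0) (hvw 0)
    simpa only [add_right_comm, sub_add_eq_add_sub] using h3

/-- Averaging a function of one row of a sign matrix. -/
theorem expect_signs_row {n d : ℕ} (i : Fin d) (G : (Fin n → ℤˣ) → ℝ) :
    (Fintype.card (Fin n → Fin d → ℤˣ) : ℝ)⁻¹ * ∑ σ : Fin n → Fin d → ℤˣ, G (fun j => σ j i) =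
      (Fintype.card (Fin n → ℤˣ) : ℝ)⁻¹ * ∑ ε, G ε := by
  -- The signs with second index `i` are split off; the remaining ones only contribute a count that
  -- cancels in the average.
  let e : (Fin n → Fin d → ℤˣ) ≃ (Fin n → ℤˣ) × ({ k // k ≠ i } → Fin n → ℤˣ) :=
    (Equiv.piComm _).trans (Equiv.funSplitAt i (Fin n → ℤˣ))
  have h1 : ∑ σ : Fin n → Fin d → ℤˣ, G (fun j => σ j i) =
      Fintype.card ({ k // k ≠ i } → Fin n → ℤˣ) * ∑ ε, G ε := by
    rw [← e.symm.sum_comp, Fintype.sum_prod_type, Finset.mul_sum]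
    refine Finset.sum_congr rfl fun ε _ => ?_
    have : ∀ y, (fun j => e.symm (ε, y) j i) = ε := fun y =>
      congrArg Prod.fst (e.apply_symm_apply (ε, y))
    simp [this]
  have h2 : (Fintype.card ({ k // k ≠ i } → Fin n → ℤˣ) : ℝ) ≠ 0 :=
    Nat.cast_ne_zero.2 Fintype.card_ne_zero
  rw [h1, Fintype.card_congr e, Fintype.card_prod, Nat.cast_mul, mul_inv, mul_assoc,
    inv_mul_cancel_left₀ h2]

/-! ### Hoeffding's lemma and McDiarmid's inequality -/

theorem integrable_of_abs_le {Ω : Type*} [MeasurableSpace Ω] {μ : Measure Ω} [IsFiniteMeasure μ]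
    {f : Ω → ℝ} (hf : Measurable f) {C : ℝ} (hC : ∀ x, |f x| ≤ C) : Integrable f μ :=
  Integrable.of_bound hf.aestronglyMeasurable C (Filter.Eventually.of_forall hC)

theorem abs_integral_le_of_abs_le {Ω : Type*} [MeasurableSpace Ω] {μ : Measure Ω}
    [IsProbabilityMeasure μ] {f : Ω → ℝ} {C : ℝ} (hC : ∀ x, |f x| ≤ C) : |∫ x, f x ∂μ| ≤ C := by
  simpa using norm_integral_le_of_norm_le_const (μ := μ) (f := f) (Filter.Eventually.of_forall hC)

/-- **Hoeffding's lemma** for a function of oscillation at most `c`. -/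
theorem integral_exp_le_of_oscillation {X : Type*} [MeasurableSpace X] {P : Measure X}
    [IsProbabilityMeasure P] {f : X → ℝ} (hf : Measurable f) {c : ℝ}
    (hc : ∀ x y, |f x - f y| ≤ c) (t : ℝ) :
    ∫ x, Real.exp (t * (f x - ∫ y, f y ∂P)) ∂P ≤ Real.exp (c ^ 2 * t ^ 2 / 8) := by
  have hne : Nonempty X := P.nonempty_of_neZero
  let x₀ := Classical.arbitrary X
  have hb : BddBelow (Set.range f) :=
    ⟨f x₀ - c, by rintro _ ⟨x, rfl⟩; have := (abs_le.1 (hc x₀ x)).2; linarith⟩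
  -- All values lie in an interval of length `c` starting at the infimum, so the variance proxy is
  -- `c² / 4`.
  have h := hasSubgaussianMGF_of_mem_Icc (μ := P) (X := f) (a := ⨅ x, f x)
    (b := (⨅ x, f x) + c) hf.aemeasurable <| Filter.Eventually.of_forall fun x =>
      ⟨ciInf_le hb x, by
        rw [← sub_le_iff_le_add]
        exact le_ciInf fun y => by have := (abs_le.1 (hc x y)).2; linarith⟩
  refine (h.mgf_le t).trans (le_of_eq ?_)
  congr 1
  simp only [add_sub_cancel_left, NNReal.coe_pow, NNReal.coe_div, coe_nnnorm, Real.norm_eq_abs,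
    NNReal.coe_ofNat, div_pow, sq_abs]
  ring

/-- The moment generating function bound behind **McDiarmid's inequality**. -/
theorem integral_exp_le_of_bounded_differences {X : Type*} [MeasurableSpace X] {P : Measure X}
    [IsProbabilityMeasure P] {c C : ℝ} (t : ℝ) :
    ∀ {n : ℕ} (f : (Fin n → X) → ℝ), Measurable f → (∀ x, |f x| ≤ C) →
      (∀ x i y, |f x - f (Function.update x i y)| ≤ c) →
      ∫ x, Real.exp (t * (f x - ∫ y, f y ∂Measure.pi fun _ => P)) ∂(Measure.pi fun _ => P) ≤
        Real.exp (n * (c ^ 2 * t ^ 2 / 8)) := by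
  intro n
  induction n with
  | zero =>
    intro f _ _ _
    have : ∀ x, f x - ∫ y, f y ∂(Measure.pi fun _ : Fin 0 => P) = 0 := fun x => by
      have h : f = fun _ => f x := funext fun y => congrArg f (Subsingleton.elim _ _)
      rw [h]; simp
    simp [this]
  | succ n ih =>
    intro f hf hC hc
    have hmp := (measurePreserving_piFinSuccAbove (fun _ : Fin (n + 1) => P) 0).symm
    have hcons : ∀ p : X × (Fin n → X),
        (MeasurableEquiv.piFinSuccAbove (fun _ : Fin (n + 1) => X) 0).symm p =
          Fin.cons p.1 p.2 := fun p => by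
      simp [MeasurableEquiv.piFinSuccAbove, Fin.insertNthEquiv]
    have hmap : ∀ g : (Fin (n + 1) → X) → ℝ,
        ∫ x, g x ∂(Measure.pi fun _ => P) =
          ∫ p, g (Fin.cons p.1 p.2) ∂(P.prod (Measure.pi fun _ : Fin n => P)) := fun g => by
      rw [← hmp.integral_comp' g]
      simp only [hcons]
    have hmc : Measurable fun p : X × (Fin n → X) => (Fin.cons p.1 p.2 : Fin (n + 1) → X) := by
      have := (MeasurableEquiv.piFinSuccAbove (fun _ : Fin (n + 1) => X) 0).symm.measurable
      simpa only [funext hcons] using this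
    have hfc : Measurable fun p : X × (Fin n → X) => f (Fin.cons p.1 p.2) := hf.comp hmc
    -- Averaging out the first coordinate preserves the mean, the bound `C` and the difference bound
    -- `c`, so the induction hypothesis applies to `g`.
    let g : (Fin n → X) → ℝ := fun z => ∫ x, f (Fin.cons x z) ∂P
    have hfz : ∀ z, Measurable fun x => f (Fin.cons x z) := fun z =>
      hfc.comp (measurable_id.prodMk measurable_const)
    have hgm : Measurable g :=
      hfc.stronglyMeasurable.integral_prod_left'.measurable
    have hgC : ∀ z, |g z| ≤ C := fun z => abs_integral_le_of_abs_le fun x => hC _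
    have hgc : ∀ z i y, |g z - g (Function.update z i y)| ≤ c := fun z i y => by
      have : g z - g (Function.update z i y) =
          ∫ x, (f (Fin.cons x z) - f (Fin.cons x (Function.update z i y))) ∂P :=
        (integral_sub (integrable_of_abs_le (hfz _) fun x => hC _)
          (integrable_of_abs_le (hfz _) fun x => hC _)).symm
      rw [this]
      refine abs_integral_le_of_abs_le fun x => ?_
      rw [Fin.cons_update]
      exact hc _ _ _
    have hmean : ∫ y, f y ∂(Measure.pi fun _ => P) = ∫ z, g z ∂(Measure.pi fun _ => P) := by
      rw [hmap, integral_prod_symm _ (integrable_of_abs_le hfc fun p => hC _)]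
    rw [hmean, hmap]
    set m := ∫ z, g z ∂(Measure.pi fun _ : Fin n => P) with hm
    have hexp : ∀ {Ω : Type _} [MeasurableSpace Ω] {μ : Measure Ω} [IsFiniteMeasure μ]
        {F : Ω → ℝ} {D : ℝ}, Measurable F → (∀ x, |F x| ≤ D) →
        Integrable (fun x => Real.exp (t * F x)) μ := by
      intro Ω _ μ _ F D hF hD
      refine integrable_of_abs_le (C := Real.exp (|t| * D)) (by fun_prop) fun x => ?_
      rw [Real.abs_exp, Real.exp_le_exp]
      refine (le_abs_self _).trans ?_
      rw [abs_mul]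
      exact mul_le_mul_of_nonneg_left (hD x) (abs_nonneg t)
    have hsubm : ∀ r s : ℝ, |r| ≤ C → |s| ≤ C → |r - s| ≤ C + C := fun r s hr hs =>
      (abs_sub _ _).trans (add_le_add hr hs)
    have hmC : |m| ≤ C := abs_integral_le_of_abs_le hgC
    rw [integral_prod_symm _ (hexp (hfc.sub_const m) fun p => hsubm _ _ (hC _) hmC)]
    calc ∫ z, ∫ x, Real.exp (t * (f (Fin.cons x z) - m)) ∂P ∂(Measure.pi fun _ : Fin n => P)
        ≤ ∫ z, Real.exp (t * (g z - m)) * Real.exp (c ^ 2 * t ^ 2 / 8)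
            ∂(Measure.pi fun _ : Fin n => P) := by
          refine integral_mono (hexp (hfc.sub_const m)
            fun p => hsubm _ _ (hC _) hmC).integral_prod_right
            ((hexp (hgm.sub_const m) fun z => hsubm _ _ (hgC z) hmC).mul_const _) fun z => ?_
          -- Given `z`, the factor with `g z - m` is constant; the other is centred in `x` and falls
          -- under Hoeffding's lemma.
          have h1 : ∀ x, Real.exp (t * (f (Fin.cons x z) - m)) =
              Real.exp (t * (g z - m)) * Real.exp (t * (f (Fin.cons x z) - g z)) := fun x => by
            rw [← Real.exp_add]; ring_nf
          simp only [h1]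
          rw [integral_const_mul]
          refine mul_le_mul_of_nonneg_left ?_ (Real.exp_pos _).le
          refine integral_exp_le_of_oscillation (hfz z) (fun x y => ?_) t
          have := hc (Fin.cons x z) 0 y
          rwa [Fin.update_cons_zero] at this
      _ = (∫ z, Real.exp (t * (g z - m)) ∂(Measure.pi fun _ : Fin n => P)) *
            Real.exp (c ^ 2 * t ^ 2 / 8) := integral_mul_const _ _
      _ ≤ Real.exp (n * (c ^ 2 * t ^ 2 / 8)) * Real.exp (c ^ 2 * t ^ 2 / 8) :=
          mul_le_mul_of_nonneg_right (ih g hgm hgC hgc) (Real.exp_pos _).le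
      _ = Real.exp ((n + 1 : ℕ) * (c ^ 2 * t ^ 2 / 8)) := by
          rw [← Real.exp_add]; push_cast; ring_nf

/-- **McDiarmid's inequality** for a bounded function of `n` independent samples of law `P`. -/
theorem measureReal_ge_le_of_bounded_differences {X : Type*} [MeasurableSpace X] {P : Measure X}
    [IsProbabilityMeasure P] {c C : ℝ} {n : ℕ} {f : (Fin n → X) → ℝ} (hf : Measurable f)
    (hC : ∀ x, |f x| ≤ C) (hc : ∀ x i y, |f x - f (Function.update x i y)| ≤ c) {ε : ℝ}
    (hε : 0 ≤ ε) :
    (Measure.pi fun _ => P).real {x | ε ≤ f x - ∫ y, f y ∂Measure.pi fun _ => P} ≤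
      Real.exp (-(2 * ε ^ 2) / (n * c ^ 2)) := by
  have hsub : HasSubgaussianMGF (fun x => f x - ∫ y, f y ∂Measure.pi fun _ => P)
      ⟨n * c ^ 2 / 4, by positivity⟩ (Measure.pi fun _ => P) := by
    refine ⟨fun t => ?_, fun t => ?_⟩
    · refine integrable_of_abs_le (C := Real.exp (|t| * (C + C))) (by fun_prop) fun x => ?_
      rw [Real.abs_exp, Real.exp_le_exp]
      refine (le_abs_self _).trans ?_
      rw [abs_mul]
      exact mul_le_mul_of_nonneg_left ((abs_sub _ _).trans
        (add_le_add (hC x) (abs_integral_le_of_abs_le hC))) (abs_nonneg t)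
    · refine (integral_exp_le_of_bounded_differences t f hf hC hc).trans (le_of_eq ?_)
      congr 1
      change _ = (n * c ^ 2 / 4) * t ^ 2 / 2
      ring
  refine (hsub.measure_ge_le hε).trans (le_of_eq ?_)
  congr 1
  change -ε ^ 2 / (2 * (n * c ^ 2 / 4)) = _
  -- In the degenerate case both quotients are `0` by the convention for division by zero, and the
  -- bound is the trivial `1`.
  by_cases h : (n : ℝ) * c ^ 2 = 0
  · simp [h]
  · field_simp
    try ring

/-! ### Measurable suprema and symmetrization -/

theorem MeasureTheory.MeasurePreserving.integral_comp_of_measurable {Ω Ω' : Type*}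
    [MeasurableSpace Ω] [MeasurableSpace Ω'] {μ : Measure Ω} {ν : Measure Ω'} {s : Ω → Ω'}
    (hs : MeasurePreserving s μ ν) {g : Ω' → ℝ} (hg : Measurable g) :
    ∫ w, g (s w) ∂μ = ∫ z, g z ∂ν := by
  rw [← hs.map_eq, integral_map hs.measurable.aemeasurable hg.aestronglyMeasurable]

/-- Suprema over a class of linear combinations of means and sample values are measurable. -/
def MeasurableSampleSuprema {ι X : Type*} [MeasurableSpace X] (P : Measure X) (u : ι → X → ℝ) :
    Prop :=
  ∀ (m : ℕ) (c₀ : ℝ) (c : Fin m → ℝ),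
    Measurable fun x : Fin m → X => ⨆ f, (c₀ * ∫ z, u f z ∂P + ∑ j, c j * u f (x j))

theorem MeasurableSampleSuprema.measurable_signs {ι X : Type*} [MeasurableSpace X] {P : Measure X}
    {u : ι → X → ℝ} (hM : MeasurableSampleSuprema P u) {n : ℕ} (ε : Fin n → ℤˣ) :
    Measurable fun x : Fin n → X => ⨆ f, ∑ j, ((ε j : ℤ) : ℝ) * u f (x j) := by
  simpa using hM n 0 fun j => ((ε j : ℤ) : ℝ)

theorem MeasurableSampleSuprema.measurable_deviation {ι X : Type*} [MeasurableSpace X]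
    {P : Measure X} {u : ι → X → ℝ} (hM : MeasurableSampleSuprema P u) (n : ℕ) :
    Measurable fun x : Fin n → X => ⨆ f, (n * (∫ z, u f z ∂P) - ∑ j, u f (x j)) := by
  simpa [sub_eq_add_neg] using hM n n fun _ => -1

/-- A sample paired with its ghost copy is one sample of size `n + n`, with coefficients `ε` on the
ghost half and `-ε` on the other. -/
theorem MeasurableSampleSuprema.measurable_ghost {ι X : Type*} [MeasurableSpace X] {P : Measure X}
    {u : ι → X → ℝ} (hM : MeasurableSampleSuprema P u) {n : ℕ} (ε : Fin n → ℤˣ) :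
    Measurable fun w : Fin n → X × X =>
      ⨆ f, ∑ j, ((ε j : ℤ) : ℝ) * (u f (w j).2 - u f (w j).1) := by
  have h := hM (n + n) 0 (Fin.append (fun j => ((ε j : ℤ) : ℝ)) fun j => -((ε j : ℤ) : ℝ))
  have hs : Measurable fun w : Fin n → X × X =>
      (Fin.append (fun j => (w j).2) fun j => (w j).1 : Fin (n + n) → X) := by
    refine measurable_pi_iff.2 fun k => ?_
    induction k using Fin.addCases with
    | left j => simpa only [Fin.append_left, Function.comp_def] using
        measurable_snd.comp (measurable_pi_apply (X := fun _ : Fin n => X × X) j)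
    | right j => simpa only [Fin.append_right, Function.comp_def] using
        measurable_fst.comp (measurable_pi_apply (X := fun _ : Fin n => X × X) j)
  convert h.comp hs using 2 with w
  simp only [Function.comp_apply, Fin.sum_univ_add, Fin.append_left, Fin.append_right, mul_add,
    mul_neg, Finset.sum_add_distrib, zero_mul, zero_add, neg_mul, Finset.sum_neg_distrib, sub_eq_add_neg]

theorem abs_deviation_le {ι X : Type*} [MeasurableSpace X] {P : Measure X}
    [IsProbabilityMeasure P] {u : ι → X → ℝ} {C : ℝ} (hu : ∀ f x, |u f x| ≤ C) {n : ℕ}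
    (x : Fin n → X) (f : ι) : |n * (∫ z, u f z ∂P) - ∑ j, u f (x j)| ≤ n * C + n * C := by
  refine (abs_sub _ _).trans (add_le_add ?_ ?_)
  · rw [abs_mul, Nat.abs_cast]
    exact mul_le_mul_of_nonneg_left (abs_integral_le_of_abs_le (hu f)) n.cast_nonneg
  · simpa using abs_sum_signs_mul_le (n := n) 1 fun j => hu f (x j)

/-- **Symmetrization**: the expected largest deviation of sample sums from their means is at most
twice the Rademacher average. -/
theorem integral_ciSup_deviation_le {ι X : Type*} [Nonempty ι] [MeasurableSpace X] {P : Measure X}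
    [IsProbabilityMeasure P] {u : ι → X → ℝ} {C : ℝ} (hu : ∀ f x, |u f x| ≤ C)
    (hm : ∀ f, Measurable (u f)) (hM : MeasurableSampleSuprema P u) (n : ℕ) :
    ∫ x : Fin n → X, ⨆ f, (n * (∫ z, u f z ∂P) - ∑ j, u f (x j)) ∂(Measure.pi fun _ => P) ≤
      2 * ((Fintype.card (Fin n → ℤˣ) : ℝ)⁻¹ * ∑ ε : Fin n → ℤˣ,
        ∫ x : Fin n → X, ⨆ f, ∑ j, ((ε j : ℤ) : ℝ) * u f (x j) ∂(Measure.pi fun _ => P)) := by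
  set μ := Measure.pi fun _ : Fin n => P with hμ
  set ν := Measure.pi fun _ : Fin n => P.prod P with hν
  set R : (Fin n → ℤˣ) → ℝ := fun ε => ∫ x, ⨆ f, ∑ j, ((ε j : ℤ) : ℝ) * u f (x j) ∂μ with hR
  let H : (Fin n → ℤˣ) → (Fin n → X × X) → ℝ := fun ε w =>
    ⨆ f, ∑ j, ((ε j : ℤ) : ℝ) * (u f (w j).2 - u f (w j).1)
  have hHm : ∀ ε, Measurable (H ε) := fun ε => hM.measurable_ghost ε
  have hHb : ∀ (ε : Fin n → ℤˣ) (w : Fin n → X × X) f,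
      |∑ j, ((ε j : ℤ) : ℝ) * (u f (w j).2 - u f (w j).1)| ≤ n * (C + C) :=
    fun ε w f => abs_sum_signs_mul_le ε fun j =>
      (abs_sub _ _).trans (add_le_add (hu _ _) (hu _ _))
  have hHi : ∀ ε, Integrable (H ε) ν := fun ε =>
    integrable_of_abs_le (hHm ε) fun w => abs_ciSup_le (hHb ε w)
  -- The means are written as expectations over a ghost sample, and a supremum of expectations is at
  -- most the expectation of the supremum.
  have hdev : ∫ x : Fin n → X, ⨆ f, (n * (∫ z, u f z ∂P) - ∑ j, u f (x j)) ∂μ ≤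
      ∫ w, H 1 w ∂ν := by
    have he := (measurePreserving_arrowProdEquivProdArrow X X (Fin n) (fun _ => P) fun _ => P).symm
    rw [← he.integral_comp' (H 1)]
    have hi := he.integrable_comp_of_integrable (hHi 1)
    refine le_trans ?_ (integral_prod _ hi).ge
    refine integral_mono (integrable_of_abs_le (C := n * C + n * C) (hM.measurable_deviation n)
      fun x => abs_ciSup_le fun f => abs_deviation_le hu x f)
      hi.integral_prod_left fun x => ?_
    · refine ciSup_le fun f => ?_
      have hint : ∀ j : Fin n, Integrable (fun y : Fin n → X => u f (y j)) μ := fun j =>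
        integrable_of_abs_le ((hm f).comp (measurable_pi_apply j)) fun y => hu f _
      have hd : ∀ j : Fin n, Integrable (fun y : Fin n → X => u f (y j) - u f (x j)) μ :=
        fun j => (hint j).sub (integrable_const _)
      have hval : n * (∫ z, u f z ∂P) - ∑ j, u f (x j) =
          ∫ y, ∑ j, (((1 : Fin n → ℤˣ) j : ℤ) : ℝ) * (u f (y j) - u f (x j)) ∂μ := by
        simp only [Pi.one_apply, Units.val_one, Int.cast_one, one_mul]
        rw [integral_finsetSum _ fun j _ => hd j]
        have : ∀ j : Fin n, ∫ y, (u f (y j) - u f (x j)) ∂μ = (∫ z, u f z ∂P) - u f (x j) :=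
          fun j => by
            rw [integral_sub (hint j) (integrable_const _),
              (measurePreserving_eval (fun _ : Fin n => P) j).integral_comp_of_measurable (hm f)]
            simp
        simp [this, Finset.sum_sub_distrib]
      rw [hval]
      refine integral_mono (integrable_finsetSum _ fun j _ =>
        (hd j).const_mul _) (integrable_of_abs_le
          ((hHm 1).comp (he.measurable.comp (measurable_const.prodMk measurable_id)))
          fun y => abs_ciSup_le (hHb 1 _)) fun y => ?_
      exact le_ciSup (bddAbove_range_of_abs_le
        (hHb 1 ((MeasurableEquiv.arrowProdEquivProdArrow X X (Fin n)).symm (x, y)))) f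
  -- Exchanging a point with its ghost where `ε j = -1` preserves the law and flips the sign of that
  -- term.
  have hswap : ∀ ε, ∫ w, H 1 w ∂ν = ∫ w, H ε w ∂ν := fun ε => by
    have hs : MeasurePreserving (fun (w : Fin n → X × X) j =>
        (if ε j = 1 then id else Prod.swap) (w j)) ν ν := by
      refine measurePreserving_pi _ _ fun j => ?_
      split_ifs
      · exact MeasurePreserving.id _
      · exact Measure.measurePreserving_swap
    rw [← hs.integral_comp_of_measurable (hHm 1)]
    refine integral_congr_ae (Filter.Eventually.of_forall fun w => ?_)
    refine iSup_congr fun f => Finset.sum_congr rfl fun j _ => ?_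
    rcases Int.units_eq_one_or (ε j) with h | h <;> simp [h]
  have hRm : ∀ ε : Fin n → ℤˣ, Measurable fun x : Fin n → X =>
      ⨆ f, ∑ j, ((ε j : ℤ) : ℝ) * u f (x j) := fun ε => hM.measurable_signs ε
  have hRb : ∀ (ε : Fin n → ℤˣ) (x : Fin n → X) f,
      |∑ j, ((ε j : ℤ) : ℝ) * u f (x j)| ≤ n * C := fun ε x f =>
    abs_sum_signs_mul_le ε fun j => hu f _
  -- The ghost half carries `ε`, the sample half `-ε`. Summed over all signs both give the same
  -- total, hence the factor 2.
  have hsplit : ∀ ε, ∫ w, H ε w ∂ν ≤ R ε + R (-ε) := fun ε => by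
    have h2 : MeasurePreserving (fun (w : Fin n → X × X) j => (w j).2) ν μ :=
      measurePreserving_pi _ _ fun _ => measurePreserving_snd
    have h1 : MeasurePreserving (fun (w : Fin n → X × X) j => (w j).1) ν μ :=
      measurePreserving_pi _ _ fun _ => measurePreserving_fst
    have hi2 := integrable_of_abs_le (μ := ν) ((hRm ε).comp h2.measurable)
      fun w => abs_ciSup_le (hRb ε _)
    have hi1 := integrable_of_abs_le (μ := ν) ((hRm (-ε)).comp h1.measurable)
      fun w => abs_ciSup_le (hRb (-ε) _)
    have e : R ε + R (-ε) = ∫ w, ((⨆ f, ∑ j, ((ε j : ℤ) : ℝ) * u f (w j).2) +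
        ⨆ f, ∑ j, (((-ε) j : ℤ) : ℝ) * u f (w j).1) ∂ν := by
      refine Eq.trans ?_ (integral_add hi2 hi1).symm
      exact congrArg₂ _ (h2.integral_comp_of_measurable (hRm ε)).symm
        (h1.integral_comp_of_measurable (hRm (-ε))).symm
    rw [e]
    refine integral_mono (hHi ε) (hi2.add hi1) fun w => ?_
    refine le_trans (le_of_eq (iSup_congr fun f => ?_))
      (ciSup_add_le_of_abs_le (hRb ε fun j => (w j).2) (hRb (-ε) fun j => (w j).1))
    rw [← Finset.sum_add_distrib]
    refine Finset.sum_congr rfl fun j _ => ?_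
    simp
    ring
  refine hdev.trans ?_
  have hcard : (0 : ℝ) < Fintype.card (Fin n → ℤˣ) := Nat.cast_pos.2 Fintype.card_pos
  have hsum : (Fintype.card (Fin n → ℤˣ) : ℝ) * ∫ w, H 1 w ∂ν ≤ 2 * ∑ ε, R ε := by
    calc (Fintype.card (Fin n → ℤˣ) : ℝ) * ∫ w, H 1 w ∂ν
        = ∑ _ε : Fin n → ℤˣ, ∫ w, H 1 w ∂ν := by simp
      _ ≤ ∑ ε, (R ε + R (-ε)) := Finset.sum_le_sum fun ε _ => (hswap ε).le.trans (hsplit ε)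
      _ = 2 * ∑ ε, R ε := by
        rw [Finset.sum_add_distrib, two_mul]
        exact congrArg _ (Equiv.sum_comp (Equiv.neg (Fin n → ℤˣ)) R)
  rw [mul_left_comm, ← div_eq_inv_mul, le_div_iff₀ hcard, mul_comm]
  exact hsum

/-! ### Rademacher complexity of vector classes -/

theorem measurable_hStepState {S A : Type*} [MeasurableSpace S] [MeasurableSpace A]
    {T : S → A → S} (hT : Measurable (Function.uncurry T)) :
    ∀ h : ℕ, Measurable fun p : S × (Fin h → A) => hStepState T h p.1 p.2
  | 0 => measurable_fst
  | h + 1 => by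
    have ha : ∀ i : Fin (h + 1), Measurable fun p : S × (Fin (h + 1) → A) => p.2 i := fun i =>
      (measurable_pi_apply i).comp measurable_snd
    exact (measurable_hStepState hT h).comp
      ((hT.comp (measurable_fst.prodMk (ha 0))).prodMk (measurable_pi_iff.2 fun i => ha i.succ))

theorem abs_coe_le_one (y : UnitBall1) : |(y : ℝ)| ≤ 1 := abs_le.2 y.2

theorem HasMeasurableSuprema.measurableSampleSuprema {X : Type*} [MeasurableSpace X]
    {P : Measure X} {F : Set (X → UnitBall1)} (hF : HasMeasurableSuprema P F)
    {φ : X → UnitBall1 → ℝ} (hφ : Measurable (Function.uncurry φ)) (hc : ∀ x, Continuous (φ x))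
    {C : ℝ} (hC : ∀ x y, |φ x y| ≤ C) :
    MeasurableSampleSuprema P fun (f : F) x => φ x ((f : X → UnitBall1) x) := fun m c₀ c =>
  hF m φ hφ hc ⟨C, hC⟩ c₀ c

/-- The Rademacher complexity of a class of scalar functions. -/
noncomputable def scalarRademacher {X : Type*} [MeasurableSpace X] (P : Measure X) (n : ℕ)
    (F : Set (X → UnitBall1)) : ℝ :=
  (Fintype.card (Fin n → ℤˣ) : ℝ)⁻¹ * ∑ ε : Fin n → ℤˣ,
    ∫ x : Fin n → X, ⨆ f : F, ∑ j, ((ε j : ℤ) : ℝ) * (1 / n * ((f : X → UnitBall1) (x j) : ℝ))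
      ∂(Measure.pi fun _ => P)

theorem abs_scaled_coe_le {n : ℕ} (y : UnitBall1) : |1 / (n : ℝ) * (y : ℝ)| ≤ 1 / n := by
  rw [abs_mul, abs_of_nonneg (by positivity : (0 : ℝ) ≤ 1 / n)]
  exact mul_le_of_le_one_right (by positivity) (abs_coe_le_one y)

theorem integrable_rademacher_ciSup {X : Type*} [MeasurableSpace X] {P : Measure X}
    [IsProbabilityMeasure P] {F : Set (X → UnitBall1)} [Nonempty F]
    (hF : HasMeasurableSuprema P F) {n : ℕ} (ε : Fin n → ℤˣ) :
    Integrable (fun x : Fin n → X => ⨆ f : F, ∑ j, ((ε j : ℤ) : ℝ) *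
      (1 / n * ((f : X → UnitBall1) (x j) : ℝ))) (Measure.pi fun _ => P) := by
  have hM := hF.measurableSampleSuprema (φ := fun _ y => 1 / (n : ℝ) * (y : ℝ)) (C := 1 / n)
    ((measurable_subtype_coe.comp measurable_snd).const_mul _)
    (fun x => continuous_subtype_val.const_mul _) fun x y => abs_scaled_coe_le y
  exact integrable_of_abs_le (hM.measurable_signs ε) fun x => abs_ciSup_le fun f =>
    abs_sum_signs_mul_le ε fun j => abs_scaled_coe_le _

/-- For a class of all vectors with components in `F` the suprema decouple. -/
theorem rademacherComplexity_vectorClass {X : Type*} [MeasurableSpace X] {P : Measure X}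
    [IsProbabilityMeasure P] {F : Set (X → UnitBall1)} [Nonempty F]
    (hF : HasMeasurableSuprema P F) (d n : ℕ) :
    rademacherComplexity P n (vectorClass d F) = d * scalarRademacher P n F := by
  let e : (Fin d → F) ≃ vectorClass d F :=
    { toFun := fun g => ⟨fun x i => (g i : X → UnitBall1) x, fun i => (g i).2⟩
      invFun := fun g i => ⟨fun x => (g : X → StateSpace d) x i, g.2 i⟩
      left_inv := fun _ => rfl
      right_inv := fun _ => rfl }
  have hsup : ∀ (σ : Fin n → Fin d → ℤˣ) (x : Fin n → X),
      ⨆ g : vectorClass d F, (1 / (n : ℝ)) *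
        ∑ j, ∑ i, ((σ j i : ℤ) : ℝ) * ((g : X → StateSpace d) (x j) i : ℝ) =
      ∑ i, ⨆ f : F, ∑ j, ((σ j i : ℤ) : ℝ) * (1 / n * ((f : X → UnitBall1) (x j) : ℝ)) := by
    intro σ x
    rw [← e.iSup_comp, ← ciSup_pi_sum fun i f => abs_sum_signs_mul_le (fun j => σ j i)
      fun j => abs_scaled_coe_le _]
    refine iSup_congr fun g => ?_
    rw [Finset.sum_comm, Finset.mul_sum]
    refine Finset.sum_congr rfl fun i _ => ?_
    rw [Finset.mul_sum]
    exact Finset.sum_congr rfl fun j _ => mul_left_comm _ _ _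
  simp only [rademacherComplexity, hsup]
  simp only [integral_finsetSum Finset.univ fun i _ =>
    integrable_rademacher_ciSup hF (n := n) (P := P) fun j => _]
  rw [Finset.sum_comm, Finset.mul_sum]
  simp only [expect_signs_row _ fun ε : Fin n → ℤˣ => ∫ x : Fin n → X, ⨆ f : F,
    ∑ j, ((ε j : ℤ) : ℝ) * (1 / n * ((f : X → UnitBall1) (x j) : ℝ)) ∂(Measure.pi fun _ => P)]
  simp [scalarRademacher]

/-- Contraction applied for each fixed sample and then integrated. The sum over signs has to go
inside the integral, because contraction compares sums over all signs, not individual terms. -/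
theorem scaled_sum_signs_integral_le {X : Type*} [MeasurableSpace X] {P : Measure X}
    [IsProbabilityMeasure P] {F : Set (X → UnitBall1)} [Nonempty F]
    (hF : HasMeasurableSuprema P F) {n : ℕ} {v : F → X → ℝ} {C : ℝ}
    (hC : ∀ f x, |v f x| ≤ C) (hM : MeasurableSampleSuprema P v)
    (hv : ∀ f g x, |v f x - v g x| ≤ |1 / (n : ℝ) * ((f : X → UnitBall1) x : ℝ) -
      1 / n * ((g : X → UnitBall1) x : ℝ)|) :
    (Fintype.card (Fin n → ℤˣ) : ℝ)⁻¹ * ∑ ε : Fin n → ℤˣ,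
      ∫ x : Fin n → X, ⨆ f, ∑ j, ((ε j : ℤ) : ℝ) * v f (x j) ∂(Measure.pi fun _ => P) ≤
      scalarRademacher P n F := by
  have hi : ∀ ε : Fin n → ℤˣ, Integrable (fun x : Fin n → X =>
      ⨆ f, ∑ j, ((ε j : ℤ) : ℝ) * v f (x j)) (Measure.pi fun _ => P) := fun ε =>
    integrable_of_abs_le (hM.measurable_signs ε) fun x => abs_ciSup_le fun f =>
      abs_sum_signs_mul_le ε fun j => hC f (x j)
  refine mul_le_mul_of_nonneg_left ?_ (by positivity)
  rw [← integral_finsetSum _ fun ε _ => hi ε,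
    ← integral_finsetSum _ fun ε _ => integrable_rademacher_ciSup hF ε]
  refine integral_mono (integrable_finsetSum _ fun ε _ => hi ε)
    (integrable_finsetSum _ fun ε _ => integrable_rademacher_ciSup hF ε) fun x => ?_
  have h := sum_signs_ciSup_le_of_contraction (C := max C (1 / n)) (fun _ : F => 0) 0
    (fun _ => by simp) (fun j f => v f (x j))
    (fun j f => 1 / n * ((f : X → UnitBall1) (x j) : ℝ))
    (fun j f => (hC f (x j)).trans (le_max_left _ _))
    (fun j f => (abs_scaled_coe_le _).trans (le_max_right _ _)) fun j f g => hv f g (x j)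
  simpa only [zero_add] using h

/-- The zero function is a contraction of every class, and its Rademacher average vanishes. -/
theorem scalarRademacher_nonneg {X : Type*} [MeasurableSpace X] {P : Measure X}
    [IsProbabilityMeasure P] {F : Set (X → UnitBall1)} [Nonempty F]
    (hF : HasMeasurableSuprema P F) (n : ℕ) : 0 ≤ scalarRademacher P n F := by
  have h := scaled_sum_signs_integral_le hF (n := n) (v := fun _ _ => 0) (C := 0)
    (fun _ _ => by simp) (fun m c₀ c => by simp) (fun f g x => by simp)
  simpa using h

/-! ### Deviation of the absolute loss -/

theorem scaledLoss_bounds {n : ℕ} (a y : UnitBall1) :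
    0 ≤ 1 / (n : ℝ) * |(a : ℝ) - y| ∧ 1 / (n : ℝ) * |(a : ℝ) - y| ≤ 2 / n := by
  refine ⟨by positivity, ?_⟩
  have h : |(a : ℝ) - y| ≤ 2 := by
    have := abs_sub (a : ℝ) y
    have h1 := abs_coe_le_one a
    have h2 := abs_coe_le_one y
    linarith
  rw [one_div_mul_eq_div]
  gcongr

theorem abs_scaledLoss_le {n : ℕ} (a y : UnitBall1) : |1 / (n : ℝ) * (|(a : ℝ) - y|)| ≤ 2 / n := by
  rw [abs_of_nonneg (scaledLoss_bounds a y).1]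
  exact (scaledLoss_bounds a y).2

/-- Symmetrization contributes the factor 2; contraction costs nothing, as the scaled loss varies no
more than `f x / n`. -/
theorem integral_ciSup_loss_deviation_le {X : Type*} [MeasurableSpace X] {P : Measure X}
    [IsProbabilityMeasure P] {F : Set (X → UnitBall1)} [Nonempty F] (hFm : ∀ f ∈ F, Measurable f)
    (hF : HasMeasurableSuprema P F) {t : X → UnitBall1} (ht : Measurable t) (n : ℕ)
    (hM : MeasurableSampleSuprema P fun (f : F) x =>
      1 / (n : ℝ) * |(t x : ℝ) - (f : X → UnitBall1) x|) :
    ∫ x : Fin n → X, ⨆ f : F, (n * (∫ z, 1 / (n : ℝ) * |(t z : ℝ) - (f : X → UnitBall1) z| ∂P) -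
        ∑ j, 1 / (n : ℝ) * |(t (x j) : ℝ) - (f : X → UnitBall1) (x j)|)
      ∂(Measure.pi fun _ => P) ≤ 2 * scalarRademacher P n F := by
  let u : F → X → ℝ := fun f x => 1 / (n : ℝ) * |(t x : ℝ) - (f : X → UnitBall1) x|
  have hm : ∀ f, Measurable (u f) := fun f => (measurable_norm.comp
    ((measurable_subtype_coe.comp ht).sub (measurable_subtype_coe.comp (hFm f f.2)))).const_mul _
  have hu : ∀ f x, |u f x| ≤ 2 / n := fun f x => abs_scaledLoss_le (t x) _
  have hlip : ∀ f g x, |u f x - u g x| ≤ |1 / (n : ℝ) * ((f : X → UnitBall1) x : ℝ) -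
      1 / n * ((g : X → UnitBall1) x : ℝ)| := fun f g x => by
    rw [← mul_sub, ← mul_sub, abs_mul, abs_mul]
    refine mul_le_mul_of_nonneg_left ((abs_abs_sub_abs_le _ _).trans (le_of_eq ?_)) (abs_nonneg _)
    rw [sub_sub_sub_cancel_left, abs_sub_comm]
  exact (integral_ciSup_deviation_le hu hm hM n).trans
    (mul_le_mul_of_nonneg_left (scaled_sum_signs_integral_le hF hu hM hlip) zero_le_two)

/-- Changing one of the sample points changes the largest deviation by at most the width
`c` of an interval containing the values of the functions. -/
theorem abs_ciSup_deviation_sub_update_le {ι X : Type*} [Nonempty ι] [MeasurableSpace X]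
    {P : Measure X} [IsProbabilityMeasure P] {u : ι → X → ℝ} {c : ℝ}
    (h0 : ∀ f x, 0 ≤ u f x) (hc : ∀ f x, u f x ≤ c) {n : ℕ} (x : Fin n → X) (k : Fin n) (y : X) :
    |(⨆ f, (n * (∫ z, u f z ∂P) - ∑ j, u f (x j))) -
      ⨆ f, (n * (∫ z, u f z ∂P) - ∑ j, u f (Function.update x k y j))| ≤ c := by
  have hb : ∀ (x : Fin n → X) f, |n * (∫ z, u f z ∂P) - ∑ j, u f (x j)| ≤ n * c + n * c :=
    fun x f => abs_deviation_le (fun f x => abs_le.2 ⟨by linarith [h0 f x, hc f x], hc f x⟩) x f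
  refine abs_ciSup_sub_ciSup_le (hb x) (hb _) fun f => ?_
  rw [sub_sub_sub_cancel_left, ← Finset.sum_sub_distrib,
    Finset.sum_eq_single_of_mem k (Finset.mem_univ k)
      fun j _ hj => by rw [Function.update_of_ne hj, sub_self], Function.update_self, abs_le]
  constructor <;> linarith [h0 f y, h0 f (x k), hc f y, hc f (x k)]

/-- The largest deviation, over models with components in `F`, of the expected from the empirical
loss, one component at a time. -/
noncomputable def lossDeviation {X : Type*} [MeasurableSpace X] {d n : ℕ} (P : Measure X)
    (t : X → StateSpace d) (F : Set (X → UnitBall1)) (x : Fin n → X) : ℝ :=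
  ∑ i, ⨆ f : F, (n * (∫ z, 1 / (n : ℝ) * |(t z i : ℝ) - (f : X → UnitBall1) z| ∂P) -
    ∑ j, 1 / (n : ℝ) * |(t (x j) i : ℝ) - (f : X → UnitBall1) (x j)|)

section

variable {X : Type*} [MeasurableSpace X] {P : Measure X}
  {F : Set (X → UnitBall1)} {d n : ℕ} {t : X → StateSpace d}

theorem measurableSampleSuprema_loss (hF : HasMeasurableSuprema P F) (ht : Measurable t)
    (i : Fin d) : MeasurableSampleSuprema P fun (f : F) x =>
      1 / (n : ℝ) * |(t x i : ℝ) - (f : X → UnitBall1) x| := by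
  refine hF.measurableSampleSuprema (φ := fun x y => 1 / (n : ℝ) * |(t x i : ℝ) - (y : ℝ)|)
    (C := 2 / n) ?_ (fun x => by fun_prop) fun x y => abs_scaledLoss_le (t x i) y
  have h1 : Measurable fun p : X × UnitBall1 => (t p.1 i : ℝ) :=
    measurable_subtype_coe.comp ((measurable_pi_apply i).comp (ht.comp measurable_fst))
  have h2 : Measurable fun p : X × UnitBall1 => (p.2 : ℝ) :=
    measurable_subtype_coe.comp measurable_snd
  exact (measurable_norm.comp (h1.sub h2)).const_mul _

theorem measurable_lossDeviation (hF : HasMeasurableSuprema P F) (ht : Measurable t) :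
    Measurable (lossDeviation (n := n) P t F) :=
  Finset.measurable_sum _ fun i _ => (measurableSampleSuprema_loss hF ht i).measurable_deviation n

variable [IsProbabilityMeasure P]

theorem abs_ciSup_lossDeviation_le [Nonempty F] (i : Fin d) (x : Fin n → X) :
    |⨆ f : F, (n * (∫ z, 1 / (n : ℝ) * |(t z i : ℝ) - (f : X → UnitBall1) z| ∂P) -
      ∑ j, 1 / (n : ℝ) * |(t (x j) i : ℝ) - (f : X → UnitBall1) (x j)|)| ≤
      n * (2 / n) + n * (2 / n) :=
  abs_ciSup_le fun f => abs_deviation_le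
    (u := fun (f : F) x => 1 / (n : ℝ) * |(t x i : ℝ) - (f : X → UnitBall1) x|)
    (fun _ x => abs_scaledLoss_le (t x i) _) x f

theorem abs_lossDeviation_le [Nonempty F] (x : Fin n → X) :
    |lossDeviation P t F x| ≤ d * (n * (2 / n) + n * (2 / n)) := by
  refine (Finset.abs_sum_le_sum_abs _ _).trans ?_
  refine (Finset.sum_le_sum fun i _ => abs_ciSup_lossDeviation_le i x).trans (le_of_eq ?_)
  rw [Finset.sum_const, Finset.card_univ, Fintype.card_fin, nsmul_eq_mul]

/-- Each of the `d` suprema moves by at most `2/n`, since the scaled losses lie in `[0, 2/n]`; using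
only their absolute bound would double this. -/
theorem abs_lossDeviation_sub_update_le [Nonempty F] (x : Fin n → X) (k : Fin n) (y : X) :
    |lossDeviation P t F x - lossDeviation P t F (Function.update x k y)| ≤ d * (2 / n) := by
  rw [lossDeviation, lossDeviation, ← Finset.sum_sub_distrib]
  refine (Finset.abs_sum_le_sum_abs _ _).trans ?_
  refine (Finset.sum_le_sum (g := fun _ => 2 / (n : ℝ)) fun i _ => ?_).trans (by simp)
  exact abs_ciSup_deviation_sub_update_le
    (u := fun (f : F) x => 1 / (n : ℝ) * |(t x i : ℝ) - (f : X → UnitBall1) x|)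
    (fun _ _ => (scaledLoss_bounds _ _).1) (fun _ _ => (scaledLoss_bounds _ _).2) x k y

theorem integral_lossDeviation_le [Nonempty F] (hFm : ∀ f ∈ F, Measurable f)
    (hF : HasMeasurableSuprema P F) (ht : Measurable t) :
    ∫ x : Fin n → X, lossDeviation P t F x ∂(Measure.pi fun _ => P) ≤
      2 * rademacherComplexity P n (vectorClass d F) := by
  simp only [lossDeviation]
  rw [integral_finsetSum _ fun i _ => integrable_of_abs_le
    ((measurableSampleSuprema_loss hF ht i).measurable_deviation n)
    fun x => abs_ciSup_lossDeviation_le i x]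
  refine (Finset.sum_le_sum fun i _ => integral_ciSup_loss_deviation_le hFm hF
    ((measurable_pi_apply i).comp ht) n (measurableSampleSuprema_loss hF ht i)).trans (le_of_eq ?_)
  rw [rademacherComplexity_vectorClass hF, Finset.sum_const, Finset.card_univ, Fintype.card_fin,
    nsmul_eq_mul, mul_left_comm]

/-- The `i`-th component of `g` competes in the `i`-th supremum. This holds for every sample, so `g`
may depend on it. -/
theorem generalizationError_le (hn : 0 < n) (hFm : ∀ f ∈ F, Measurable f) (ht : Measurable t)
    {g : X → StateSpace d} (hg : g ∈ vectorClass d F) (x : Fin n → X) :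
    generalizationError P t g ≤ lossDeviation P t F x + trainingError t g x := by
  have hn' : (n : ℝ) ≠ 0 := Nat.cast_ne_zero.2 hn.ne'
  have hint : ∀ i, Integrable (fun z => |(t z i : ℝ) - g z i|) P := fun i => by
    have h1 : Measurable fun z => (t z i : ℝ) :=
      measurable_subtype_coe.comp ((measurable_pi_apply i).comp ht)
    have h2 : Measurable fun z => (g z i : ℝ) := measurable_subtype_coe.comp (hFm _ (hg i))
    refine integrable_of_abs_le (C := 1 + 1) (measurable_norm.comp (h1.sub h2)) fun z => ?_
    rw [abs_abs]
    exact (abs_sub _ _).trans (add_le_add (abs_coe_le_one _) (abs_coe_le_one _))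
  rw [← sub_le_iff_le_add, generalizationError, trainingError]
  simp only [l1Dist]
  rw [integral_finsetSum _ fun i _ => hint i, Finset.sum_comm, Finset.mul_sum,
    ← Finset.sum_sub_distrib]
  refine Finset.sum_le_sum fun i _ => ?_
  have h := le_ciSup (bddAbove_range_of_abs_le fun f => abs_deviation_le (P := P)
    (u := fun (f : F) x => 1 / (n : ℝ) * |(t x i : ℝ) - (f : X → UnitBall1) x|)
    (fun _ x => abs_scaledLoss_le (t x i) _) x f) ⟨_, hg i⟩
  refine le_trans (le_of_eq ?_) h
  rw [integral_const_mul, ← mul_assoc, mul_one_div_cancel hn', one_mul, Finset.mul_sum]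

theorem measureReal_lossDeviation_ge_le [Nonempty F] (hn : 0 < n) (hd : 0 < d)
    (hF : HasMeasurableSuprema P F) (ht : Measurable t) {δ : ℝ} (hδ₀ : 0 < δ) (hδ₁ : δ < 1) :
    (Measure.pi fun _ : Fin n => P).real {x | d * √(2 * Real.log (1 / δ) / n) ≤
      lossDeviation P t F x - ∫ y : Fin n → X, lossDeviation P t F y ∂(Measure.pi fun _ => P)} ≤ δ := by
  have hn' : (0 : ℝ) < n := Nat.cast_pos.2 hn
  have hd' : (0 : ℝ) < d := Nat.cast_pos.2 hd
  have hL : 0 < Real.log (1 / δ) := Real.log_pos ((one_lt_div hδ₀).2 hδ₁)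
  refine (measureReal_ge_le_of_bounded_differences (measurable_lossDeviation hF ht)
    abs_lossDeviation_le abs_lossDeviation_sub_update_le (by positivity)).trans (le_of_eq ?_)
  rw [mul_pow, Real.sq_sqrt (by positivity)]
  -- With differences `2d/n`, the threshold is the one that makes McDiarmid's exponent equal to `ln
  -- δ`.
  have : -(2 * ((d : ℝ) ^ 2 * (2 * Real.log (1 / δ) / n))) / (n * (d * (2 / n)) ^ 2) =
      Real.log δ := by
    rw [one_div, Real.log_inv]
    field_simp
  rw [this, Real.exp_log hδ₀]

end

/-! ### The generalization bound -/

theorem lemma1 {A : Type*} [MeasurableSpace A] {d h n : ℕ} (hn : 0 < n)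
    (T : StateSpace d → A → StateSpace d) (hT : Measurable (Function.uncurry T))
    (P : Measure (ModelInput A d h)) [IsProbabilityMeasure P]
    (F : Set (ModelInput A d h → UnitBall1)) (hF : ∀ f ∈ F, Measurable f)
    (hFsup : HasMeasurableSuprema P F)
    (δ : ℝ) (hδ₀ : 0 < δ) (hδ₁ : δ < 1) :
    ∃ E : Set (Fin n → ModelInput A d h), MeasurableSet E ∧
      1 - δ ≤ (Measure.pi fun _ : Fin n => P).real E ∧
      ∀ D ∈ E, ∀ That ∈ vectorClass d F,
        generalizationError P (hStepTransition T h) That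
          ≤ 2 * √2 * rademacherComplexity P n (vectorClass d F)
            + d * √(2 * Real.log (1 / δ) / n)
            + trainingError (hStepTransition T h) That D := by
  -- For `d = 0` both sides vanish. This case is separate because McDiarmid's bound degenerates to
  -- `1` there.
  rcases Nat.eq_zero_or_pos d with rfl | hd
  · refine ⟨Set.univ, MeasurableSet.univ, by simpa using hδ₀.le, fun D _ g _ => ?_⟩
    simp [generalizationError, trainingError, l1Dist, rademacherComplexity]
  -- With `d > 0` an empty `F` leaves no models; the supremum estimates need a nonempty index type.
  rcases F.eq_empty_or_nonempty with rfl | hne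
  · exact ⟨Set.univ, MeasurableSet.univ, by simpa using hδ₀.le,
      fun D _ g hg => absurd (hg ⟨0, hd⟩) (Set.notMem_empty _)⟩
  have : Nonempty F := hne.to_subtype
  have ht : Measurable (hStepTransition T h) := measurable_hStepState hT h
  set t := hStepTransition T h
  set τ := (d : ℝ) * √(2 * Real.log (1 / δ) / n)
  -- The bad event mentions no particular model, so its complement serves all models at once.
  set B : Set (Fin n → ModelInput A d h) := {x | τ ≤
    lossDeviation P t F x - ∫ y : Fin n → ModelInput A d h, lossDeviation P t F y ∂(Measure.pi fun _ => P)}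
  have hB : MeasurableSet B :=
    measurableSet_le measurable_const ((measurable_lossDeviation hFsup ht).sub_const _)
  refine ⟨Bᶜ, hB.compl, ?_, fun D hD g hg => ?_⟩
  · rw [probReal_compl_eq_one_sub hB]
    exact sub_le_sub_left (measureReal_lossDeviation_ge_le hn hd hFsup ht hδ₀ hδ₁) 1
  · have h1 := generalizationError_le (P := P) hn hF ht hg D
    have h2 : lossDeviation P t F D -
        ∫ y : Fin n → ModelInput A d h, lossDeviation P t F y ∂(Measure.pi fun _ : Fin n => P) < τ := not_le.1 hD
    have h3 := integral_lossDeviation_le (n := n) hF hFsup ht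
    have h4 : 0 ≤ rademacherComplexity P n (vectorClass d F) := by
      rw [rademacherComplexity_vectorClass hFsup]
      exact mul_nonneg d.cast_nonneg (scalarRademacher_nonneg hFsup n)
    -- The only place where `√2` enters: the factor 2 is relaxed to the stated constant.
    have h5 : 2 * rademacherComplexity P n (vectorClass d F) ≤
        2 * √2 * rademacherComplexity P n (vectorClass d F) := by
      refine mul_le_mul_of_nonneg_right ?_ h4
      linarith [Real.one_le_sqrt.2 (one_le_two : (1 : ℝ) ≤ 2)]
    linarith
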